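/- Let $H$ be a separable complex Hilbert space and let $\mathcal L$ be a commutative subspace lattice on $H$: a family of closed subspaces of $H$ that contains $0$ and $H$, is closed under arbitrary intersections and closed linear spans, and whose orthogonal projections commute with one another. Subspaces are identified with their orthogonal projections. Let $\operatorname{Alg}\mathcal L$ be the algebra of all bounded operators on $H$ that leave every element of $\mathcal L$ invariant. An \emph{atom} of $\mathcal L$ is a projection $A=P-Q$ with $P,Q\in\mathcal L$, $Q<P$, such that for every $F\in\mathcal L$ either $AF=0$ or $AF=A$. An element of $\mathcal L$ is \emph{generated} by a set of atoms if it is the smallest element of $\mathcal L$ that contains each of them. A \emph{linear manifold} is a linear subspace of $H$, not necessarily closed; it is \emph{invariant} if every $T\in\operatorname{Alg}\mathcal L$ maps it into itself. An \emph{invariant operator range} is an invariant linear manifold that is the range of a bounded linear operator on $H$. The following conditions are equivalent: \begin{enumerate} \item[(1)] $\mathcal L$ is hyperatomic: every non-zero element of $\mathcal L$ is generated by finitely many atoms. \item[(2)] Every ascending sequence $F_1\le F_2\le\cdots$ in $\mathcal L$ is eventually constant. \item[(3)] Every invariant operator range of $\operatorname{Alg}\mathcal L$ is closed. \item[(4)]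 Every invariant linear manifold of $\operatorname{Alg}\mathcal L$ is closed. \end{enumerate} Moreover, if (3) holds, then every invariant operator range is an element of $\mathcal L$, and if (4) holds, then every invariant linear manifold is an element of $\mathcal L$. If $\mathcal L$ is a nest (that is, totally ordered by inclusion), then each of the following conditions is also equivalent to (1)--(4): \begin{enumerate} \item[(5)] Every non-zero $P\in\mathcal L$ has an immediate predecessor: there is $Q\in\mathcal L$ with $Q<P$ such that no $F\in\mathcal L$ satisfies $Q<F<P$. \item[(6)] The invariant operator ranges of $\operatorname{Alg}\mathcal L$ are totally ordered by inclusion. \item[(7)] The invariant linear manifolds of $\operatorname{Alg}\mathcal L$ are totally ordered by inclusion. \end{enumerate} -/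

import Mathlib

namespace SubspaceLattice

variable {H : Type*} [NormedAddCommGroup H] [InnerProductSpace ℂ H] [CompleteSpace H]

/-- The orthogonal projection of `H` onto the closed subspace `E`, as a bounded operator on `H`. -/
noncomputable def proj (E : ClosedSubmodule ℂ H) : H →L[ℂ] H :=
  E.toSubmodule.starProjection

/-- A complete lattice of closed subspaces (it is closed under arbitrary intersections and closed
linear spans, so it contains `0` and `H`) is a commutative subspace lattice if the orthogonal
projections onto its elements commute with one another. -/
def IsCSL (L : CompleteSublattice (ClosedSubmodule ℂ H)) : Prop :=
  ∀ E ∈ L, ∀ F ∈ L, Commute (proj E) (proj F)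

/-- A nest is a subspace lattice that is totally ordered by inclusion. -/
def IsNest (L : CompleteSublattice (ClosedSubmodule ℂ H)) : Prop :=
  ∀ E ∈ L, ∀ F ∈ L, E ≤ F ∨ F ≤ E

/-- `Alg L`: the algebra of the bounded operators that leave every element of `L` invariant. -/
def Alg (L : CompleteSublattice (ClosedSubmodule ℂ H)) : Subalgebra ℂ (H →L[ℂ] H) where
  carrier := {T | ∀ E ∈ L, ∀ x ∈ E, T x ∈ E}
  mul_mem' hS hT E hE x hx := hS E hE _ (hT E hE x hx)
  add_mem' hS hT E hE x hx := add_mem (hS E hE x hx) (hT E hE x hx)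
  algebraMap_mem' c E _ x hx := by
    simpa [Algebra.algebraMap_eq_smul_one] using SMulMemClass.smul_mem c hx

/-- An atom associated with `L` is a minimal non-zero interval from `L`: a projection `A = P - Q`
with `Q < P` in `L` such that `A F` is `0` or `A` for every `F` in `L`. -/
def IsLatticeAtom (L : CompleteSublattice (ClosedSubmodule ℂ H)) (A : H →L[ℂ] H) : Prop :=
  (∃ P ∈ L, ∃ Q ∈ L, Q < P ∧ A = proj P - proj Q) ∧
    ∀ F ∈ L, A * proj F = 0 ∨ A * proj F = A

/-- The smallest element of `L` that contains the ranges of all the operators in `S`. -/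
noncomputable def generatedBy (L : CompleteSublattice (ClosedSubmodule ℂ H))
    (S : Set (H →L[ℂ] H)) : ClosedSubmodule ℂ H :=
  sInf {F | F ∈ L ∧ ∀ A ∈ S, ∀ x, A x ∈ F}

/-- `L` is hyperatomic if each of its non-zero elements is generated by finitely many atoms. -/
def IsHyperatomic (L : CompleteSublattice (ClosedSubmodule ℂ H)) : Prop :=
  ∀ P ∈ L, P ≠ ⊥ → ∃ S : Set (H →L[ℂ] H),
    S.Finite ∧ (∀ A ∈ S, IsLatticeAtom L A) ∧ P = generatedBy L S

/-- Every ascending sequence in `L` is eventually constant. -/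
def AscendingSequencesStabilize (L : CompleteSublattice (ClosedSubmodule ℂ H)) : Prop :=
  ∀ F : ℕ → ClosedSubmodule ℂ H, (∀ n, F n ∈ L) → Monotone F → ∃ n, ∀ m, n ≤ m → F m = F n

/-- A linear manifold (not necessarily closed) that is invariant under `Alg L`. -/
def IsInvariantManifold (L : CompleteSublattice (ClosedSubmodule ℂ H)) (M : Submodule ℂ H) :
    Prop :=
  ∀ T ∈ Alg L, ∀ x ∈ M, T x ∈ M

/-- An invariant linear manifold that is the range of a bounded operator on `H`. -/
def IsInvariantOperatorRange (L : CompleteSublattice (ClosedSubmodule ℂ H))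
    (M : Submodule ℂ H) : Prop :=
  IsInvariantManifold L M ∧ ∃ T : H →L[ℂ] H, (M : Set H) = Set.range T

/-- Every non-zero element `P` of `L` has an immediate predecessor: an element `Q < P` of `L` with
no element of `L` strictly in between. -/
def HasImmediatePredecessors (L : CompleteSublattice (ClosedSubmodule ℂ H)) : Prop :=
  ∀ P ∈ L, P ≠ ⊥ → ∃ Q ∈ L, Q < P ∧ ∀ F ∈ L, ¬ (Q < F ∧ F < P)

end SubspaceLattice

/-! The ascending chain condition (2) is the hub. If it fails, take a strictly ascending sequence `F
n` and let `B` be the square root of a weighted sum of the projections onto the `F n`. Douglas's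
lemma turns inclusions of ranges into norm inequalities between adjoints: it makes the range of `B`
invariant, and testing on vectors of `F (m+1)` orthogonal to `F m` shows that this range is not
closed. Weights supported on the even and on the odd indices give incomparable ranges. If (2) holds,
every `E < P` in `L` admits a `Q ≥ E` covered by `P`, and commutativity makes `P` the join of `Q`
and a join-prime `G`, whose interval over `G ⊓ Q` is an atom. Rank-one operators in `Alg L` then
force an invariant manifold to contain `G` as soon as one of its vectors is not annihilated by that
atom. Hence such a manifold is the largest element of `L` inside it, and each element of `L` is a
finite join of join-primes. -/

namespace SubspaceLattice

/-! ### Douglas's lemma and ranges of square roots of weighted sums of projections. -/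

section OperatorRanges

open ContinuousLinearMap

variable {H : Type*} [NormedAddCommGroup H] [InnerProductSpace ℂ H] [CompleteSpace H]

/-- One direction of the Douglas lemma: an inclusion of operator ranges bounds the adjoints. -/
theorem exists_norm_adjoint_le_of_range_subset {A B : H →L[ℂ] H} (h : ∀ y, ∃ z, A y = B z) :
    ∃ c : ℝ, ∀ z, ‖adjoint A z‖ ≤ c * ‖adjoint B z‖ := by
  have key : ∀ z y u, A y = B u → ‖inner ℂ (adjoint A z) y‖ ≤ ‖adjoint B z‖ * ‖u‖ := by
    intro z y u hu
    rw [adjoint_inner_left, hu, ← adjoint_inner_left]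
    exact norm_inner_le_norm _ _
  -- Normalized by `‖adjoint B z‖`, the functionals are pointwise bounded by `key`. Where `adjoint B
  -- z = 0` the inverse is `0`, so that case is settled separately by testing `key` at `adjoint A
  -- z`.
  let g : H → H →L[ℂ] ℂ := fun z => ((‖adjoint B z‖ : ℂ)⁻¹) • innerSL ℂ (adjoint A z)
  obtain ⟨C, hC⟩ := banach_steinhaus (g := g) (by
    intro y
    obtain ⟨u, hu⟩ := h y
    refine ⟨‖u‖, fun z => ?_⟩
    have hk := key z y u hu
    simp only [g, FunLike.coe_smul, Pi.smul_apply, innerSL_apply_apply, norm_smul, norm_inv,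
      Complex.norm_real, norm_norm]
    rcases (norm_nonneg (adjoint B z)).eq_or_lt with h0 | h0
    · simp [← h0]
    · rw [inv_mul_le_iff₀ h0]
      exact hk)
  refine ⟨C, fun z => ?_⟩
  rcases (norm_nonneg (adjoint B z)).eq_or_lt with h0 | h0
  · obtain ⟨u, hu⟩ := h (adjoint A z)
    have hk := key z _ u hu
    rw [← h0, zero_mul, inner_self_eq_norm_sq_to_K] at hk
    have : ‖adjoint A z‖ = 0 := by simpa using hk
    simp [← h0, this]
  · have h1 := hC z
    simp only [g, norm_smul, norm_inv, Complex.norm_real, norm_norm, innerSL_apply_norm] at h1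
    rw [inv_mul_le_iff₀ h0] at h1
    linarith

/-- The other direction of the Douglas lemma: bounded adjoints give an inclusion of ranges. -/
theorem exists_eq_of_norm_adjoint_le {A B : H →L[ℂ] H} {c : ℝ}
    (h : ∀ z, ‖adjoint A z‖ ≤ c * ‖adjoint B z‖) (y : H) : ∃ z, A y = B z := by
  let b : H →ₗ[ℂ] H := (adjoint B).toLinearMap
  obtain ⟨s, hs⟩ := b.rangeRestrict.exists_rightInverse_of_surjective b.range_rangeRestrict
  have hbs : ∀ v, adjoint B (s v) = v := fun v =>
    congrArg Subtype.val (LinearMap.congr_fun hs v)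
  -- The functional sends `adjoint B x` to `⟪A y, x⟫`. The merely linear section `s` suffices, since
  -- the hypothesis supplies both continuity and independence of the preimage.
  let f : StrongDual ℂ (LinearMap.range b) :=
    ((innerSL ℂ (A y)).toLinearMap ∘ₗ s).mkContinuous (‖y‖ * c) (by
      intro v
      have h1 : ‖inner ℂ (A y) (s v)‖ ≤ ‖y‖ * ‖adjoint A (s v)‖ := by
        rw [← adjoint_inner_right]; exact norm_inner_le_norm _ _
      have h2 := h (s v)
      rw [hbs] at h2
      calc _ ≤ ‖y‖ * ‖adjoint A (s v)‖ := h1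
        _ ≤ ‖y‖ * (c * ‖v‖) := by gcongr; exact h2
        _ = _ := by ring)
  obtain ⟨g, hg, -⟩ := exists_extension_norm_eq _ f
  refine ⟨(InnerProductSpace.toDual ℂ H).symm g, ?_⟩
  refine ext_inner_right ℂ fun x => ?_
  rw [← adjoint_inner_right B, InnerProductSpace.toDual_symm_apply]
  have h1 : g (adjoint B x) = inner ℂ (A y) (s ⟨adjoint B x, x, rfl⟩) :=
    hg ⟨adjoint B x, x, rfl⟩
  have h2 : adjoint A (x - s ⟨adjoint B x, x, rfl⟩) = 0 := by
    have := h (x - s ⟨adjoint B x, x, rfl⟩)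
    rw [map_sub (adjoint B), hbs, sub_self, norm_zero, mul_zero] at this
    exact norm_le_zero_iff.1 this
  rw [h1, ← sub_eq_zero, ← inner_sub_right, ← adjoint_inner_right, h2, inner_zero_right]

theorem proj_mem (E : ClosedSubmodule ℂ H) (x : H) : proj E x ∈ E :=
  E.toSubmodule.starProjection_apply_mem x

theorem proj_eq_self_iff {E : ClosedSubmodule ℂ H} {x : H} : proj E x = x ↔ x ∈ E :=
  E.toSubmodule.starProjection_eq_self_iff

theorem inner_proj_left (E : ClosedSubmodule ℂ H) (x y : H) :
    inner ℂ (proj E x) y = inner ℂ x (proj E y) :=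
  E.toSubmodule.inner_starProjection_left_eq_right x y

theorem proj_proj_of_le {E F : ClosedSubmodule ℂ H} (h : E ≤ F) (x : H) :
    proj E (proj F x) = proj E x :=
  DFunLike.congr_fun (Submodule.starProjection_comp_starProjection_of_le h) x

theorem norm_proj_le (E : ClosedSubmodule ℂ H) (x : H) : ‖proj E x‖ ≤ ‖x‖ :=
  E.toSubmodule.norm_starProjection_apply_le x

theorem adjoint_proj (E : ClosedSubmodule ℂ H) : adjoint (proj E) = proj E :=
  isSelfAdjoint_starProjection E.toSubmodule

/-- A positive operator has a square root, characterized by its quadratic form. -/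
theorem exists_sqrt_of_inner_nonneg {D : H →L[ℂ] H} {q : H → ℝ} (hq : ∀ x, 0 ≤ q x)
    (hD : ∀ x, inner ℂ (D x) x = (q x : ℂ)) :
    ∃ B : H →L[ℂ] H, adjoint B = B ∧ ∀ x, ‖B x‖ ^ 2 = q x := by
  have hpos : 0 ≤ D := by
    rw [nonneg_iff_isPositive, isPositive_iff_complex]
    intro x
    simp [hD, hq]
  have hsa : adjoint (CFC.sqrt D) = CFC.sqrt D := (CFC.sqrt_nonneg D).isSelfAdjoint
  refine ⟨CFC.sqrt D, hsa, fun x => ?_⟩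
  have h : inner ℂ (D x) x = (‖CFC.sqrt D x‖ ^ 2 : ℂ) := by
    conv_lhs => rw [← CFC.sqrt_mul_sqrt_self D hpos]
    rw [mul_apply_eq_comp, ← adjoint_inner_right, hsa, inner_self_eq_norm_sq_to_K]
    rfl
  exact_mod_cast (h.symm.trans (hD x))

/-- The positive square root of `∑ w n • proj (F n)`, characterized by its quadratic form. -/
theorem exists_sqrt_sum_proj (F : ℕ → ClosedSubmodule ℂ H) {w : ℕ → ℝ} (hw : ∀ n, 0 ≤ w n)
    (hs : Summable w) :
    ∃ B : H →L[ℂ] H, adjoint B = B ∧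
      ∀ x, HasSum (fun n => w n * ‖proj (F n) x‖ ^ 2) (‖B x‖ ^ 2) := by
  have hsum : Summable fun n => (w n : ℂ) • proj (F n) := by
    refine Summable.of_norm_bounded hs fun n => ?_
    rw [norm_smul, Complex.norm_real, Real.norm_of_nonneg (hw n)]
    exact mul_le_of_le_one_right (hw n) (Submodule.starProjection_norm_le _)
  obtain ⟨D, hD⟩ := hsum
  have hinner : ∀ x, HasSum (fun n => ((w n * ‖proj (F n) x‖ ^ 2 : ℝ) : ℂ)) (inner ℂ x (D x)) := by
    intro x
    have h := (innerSL ℂ x).hasSum ((ContinuousLinearMap.apply ℂ H x).hasSum hD)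
    have hn : ∀ n, inner ℂ x ((w n : ℂ) • proj (F n) x) =
        ((w n * ‖proj (F n) x‖ ^ 2 : ℝ) : ℂ) := by
      intro n
      rw [inner_smul_right, ← proj_eq_self_iff.2 (proj_mem (F n) x), ← inner_proj_left,
        proj_eq_self_iff.2 (proj_mem (F n) x), inner_self_eq_norm_sq_to_K]
      push_cast
      rfl
    exact (funext hn : _ = _) ▸ h
  have hreal := fun x => Complex.hasSum_re (hinner x)
  obtain ⟨B, hB, hBq⟩ := exists_sqrt_of_inner_nonneg (D := D)
    (q := fun x => (inner ℂ x (D x)).re)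
    (fun x => (hreal x).nonneg fun n => mul_nonneg (hw n) (sq_nonneg _)) (by
      intro x
      have him : (inner ℂ x (D x)).im = 0 := by
        have h := Complex.hasSum_im (hinner x)
        simp only [Complex.ofReal_im] at h
        exact h.unique hasSum_zero
      rw [← inner_conj_symm]
      exact Complex.ext (by rw [Complex.conj_re, Complex.ofReal_re])
        (by rw [Complex.conj_im, him, neg_zero, Complex.ofReal_im]))
  refine ⟨B, hB, fun x => ?_⟩
  rw [hBq]
  simpa only [Complex.ofReal_re] using hreal x

/-- If every `F n` is invariant for `Alg L`, then so is the range of the square root of a weighted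
sum of their projections. -/
theorem isInvariantOperatorRange_of_hasSum {L : CompleteSublattice (ClosedSubmodule ℂ H)}
    {F : ℕ → ClosedSubmodule ℂ H} (hF : ∀ n, F n ∈ L) {w : ℕ → ℝ} (hw : ∀ n, 0 ≤ w n)
    {B : H →L[ℂ] H} (hB : adjoint B = B)
    (hBq : ∀ x, HasSum (fun n => w n * ‖proj (F n) x‖ ^ 2) (‖B x‖ ^ 2)) :
    IsInvariantOperatorRange L (LinearMap.range B.toLinearMap) := by
  refine ⟨?_, B, rfl⟩
  rintro S hS _ ⟨x, rfl⟩
  -- Invariance of `F n` under `S` reads `P S* = P S* P`; this lets the quadratic form of `B` be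
  -- compared term by term.
  have hproj : ∀ n z, proj (F n) (adjoint S z) = proj (F n) (adjoint S (proj (F n) z)) := by
    intro n z
    refine ext_inner_right ℂ fun y => ?_
    have hy : S (proj (F n) y) ∈ F n := hS _ (hF n) _ (proj_mem _ _)
    rw [inner_proj_left, inner_proj_left, adjoint_inner_left, adjoint_inner_left, inner_proj_left,
      proj_eq_self_iff.2 hy]
  have hle : ∀ z, ‖adjoint (S ∘L B) z‖ ≤ ‖adjoint S‖ * ‖adjoint B z‖ := by
    intro z
    rw [adjoint_comp, hB, comp_apply]
    refine le_of_sq_le_sq ?_ (by positivity)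
    rw [mul_pow]
    refine hasSum_le (fun n => ?_) (hBq _) ((hBq z).mul_left _)
    rw [hproj, mul_left_comm, ← mul_pow]
    have : ‖proj (F n) (adjoint S (proj (F n) z))‖ ≤ ‖adjoint S‖ * ‖proj (F n) z‖ :=
      (norm_proj_le _ _).trans ((adjoint S).le_opNorm _)
    have := hw n
    gcongr
  obtain ⟨z, hz⟩ := exists_eq_of_norm_adjoint_le hle x
  exact ⟨z, hz.symm⟩

theorem norm_sq_le_tail_of_hasSum {F : ℕ → ClosedSubmodule ℂ H} (hF : Monotone F) {w : ℕ → ℝ}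
    (hw : ∀ n, 0 ≤ w n) (hs : Summable w) {m : ℕ} {z : H} (hz : proj (F m) z = 0) {r : ℝ}
    (hr : HasSum (fun n => w n * ‖proj (F n) z‖ ^ 2) r) :
    r ≤ (∑' k, w (k + (m + 1))) * ‖z‖ ^ 2 := by
  have h1 := (hasSum_nat_add_iff' (m + 1)).2 hr
  have h0 : ∑ i ∈ Finset.range (m + 1), w i * ‖proj (F i) z‖ ^ 2 = 0 := by
    refine Finset.sum_eq_zero fun i hi => ?_
    have hi' : i ≤ m := Nat.lt_succ_iff.1 (Finset.mem_range.1 hi)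
    rw [← proj_proj_of_le (hF hi') z, hz]
    simp
  rw [h0, sub_zero] at h1
  refine hasSum_le (fun k => ?_) h1 (((summable_nat_add_iff (m + 1)).2 hs).hasSum.mul_right _)
  have := norm_proj_le (F (k + (m + 1))) z
  have := hw (k + (m + 1))
  gcongr

theorem exists_mem_proj_eq_zero {E F : ClosedSubmodule ℂ H} (h : E < F) :
    ∃ z ∈ F, proj E z = 0 ∧ 0 < ‖z‖ := by
  obtain ⟨x, hxF, hxE⟩ := SetLike.exists_of_lt h
  refine ⟨x - proj E x, F.toSubmodule.sub_mem hxF (h.le (proj_mem E x)), ?_, ?_⟩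
  · rw [map_sub, proj_eq_self_iff.2 (proj_mem E x), sub_self]
  · rw [norm_pos_iff, sub_ne_zero]
    exact fun hx => hxE (proj_eq_self_iff.1 hx.symm)

theorem summable_inv_factorial : Summable fun n : ℕ => ((n.factorial : ℝ))⁻¹ := by
  simpa using Real.summable_pow_div_factorial 1

theorem tsum_inv_factorial_nat_add_le (N : ℕ) (hN : 1 ≤ N) :
    ∑' k, (((k + N).factorial : ℝ))⁻¹ ≤ 2 * ((N.factorial : ℝ))⁻¹ := by
  have hg := hasSum_geometric_two.mul_right ((N.factorial : ℝ))⁻¹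
  refine hasSum_le (fun k => ?_) ((summable_nat_add_iff N).2 summable_inv_factorial).hasSum hg
  rw [one_div, inv_pow, ← mul_inv]
  refine inv_anti₀ (by positivity) ?_
  have h : N.factorial * (N + 1) ^ k ≤ (N + k).factorial := Nat.factorial_mul_pow_le_factorial
  have h2 : 2 ^ k * N.factorial ≤ (k + N).factorial := by
    rw [add_comm k, mul_comm]
    exact (Nat.mul_le_mul_left _ (Nat.pow_le_pow_left (Nat.succ_le_succ hN) k)).trans h
  exact_mod_cast h2

/-! ### Ranges that are not closed or not comparable. -/

/-- A strictly ascending sequence in `L` yields an invariant operator range that is not closed. -/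
theorem exists_not_isClosed_of_strictMono {L : CompleteSublattice (ClosedSubmodule ℂ H)}
    {F : ℕ → ClosedSubmodule ℂ H} (hF : ∀ n, F n ∈ L) (hmono : StrictMono F) :
    ∃ M : Submodule ℂ H, IsInvariantOperatorRange L M ∧ ¬ IsClosed (M : Set H) := by
  have hs := summable_inv_factorial
  have hw : ∀ n : ℕ, 0 ≤ ((n.factorial : ℝ))⁻¹ := fun n => by positivity
  obtain ⟨B, hB, hBq⟩ := exists_sqrt_sum_proj F hw hs
  refine ⟨_, isInvariantOperatorRange_of_hasSum hF hw hB hBq, fun hcl => ?_⟩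
  have hFB : ∀ n, ∀ x ∈ F n, ∃ z, x = B z := by
    intro n x hx
    rw [← proj_eq_self_iff.2 hx]
    refine exists_eq_of_norm_adjoint_le (c := √(n.factorial)) (fun z => ?_) x
    rw [adjoint_proj, hB]
    refine le_of_sq_le_sq ?_ (by positivity)
    rw [mul_pow, Real.sq_sqrt (by positivity), ← inv_mul_le_iff₀ (by positivity)]
    exact le_hasSum (hBq z) n fun i _ => mul_nonneg (hw i) (sq_nonneg _)
  let R : ClosedSubmodule ℂ H := ⟨LinearMap.range B.toLinearMap, hcl⟩
  have hle : ∀ n, F n ≤ R := fun n x hx => (hFB n x hx).imp fun z hz => hz.symm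
  -- A closed range would bound `B` below on itself, hence on every `F n`; but `B` is as small as
  -- the tail of the weights on `F (m+1)` orthogonal to `F m`.
  obtain ⟨c, hc⟩ := exists_norm_adjoint_le_of_range_subset (A := proj R) (B := B) (fun y => by
    obtain ⟨z, hz⟩ := proj_mem R y
    exact ⟨z, hz.symm⟩)
  rw [adjoint_proj, hB] at hc
  have hone : ∀ m, 1 ≤ c ^ 2 * ∑' k, (((k + (m + 1)).factorial : ℝ))⁻¹ := by
    intro m
    obtain ⟨z, hzF, hz0, hzpos⟩ := exists_mem_proj_eq_zero (hmono (Nat.lt_succ_self m))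
    have h1 := norm_sq_le_tail_of_hasSum hmono.monotone hw hs hz0 (hBq z)
    have h2 := hc z
    rw [proj_eq_self_iff.2 (hle _ hzF)] at h2
    have h3 : ‖z‖ ^ 2 ≤ c ^ 2 * ‖B z‖ ^ 2 := by
      rw [← mul_pow]; gcongr
    have h4 : ‖z‖ ^ 2 * 1 ≤ ‖z‖ ^ 2 * (c ^ 2 * ∑' k, (((k + (m + 1)).factorial : ℝ))⁻¹) := by
      nlinarith [mul_le_mul_of_nonneg_left h1 (sq_nonneg c)]
    exact le_of_mul_le_mul_left h4 (by positivity)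
  have hlim := ((tendsto_sum_nat_add fun n : ℕ => ((n.factorial : ℝ))⁻¹).comp
    (Filter.tendsto_add_atTop_nat 1)).const_mul (c ^ 2)
  have := ge_of_tendsto' hlim hone
  norm_num at this

/-- An inclusion of weighted ranges bounds the dominating weight at the indices where the other one
vanishes. -/
theorem factorial_weight_le_of_range_le {F : ℕ → ClosedSubmodule ℂ H} (hmono : StrictMono F)
    {v w : ℕ → ℝ} (hv : ∀ n, 0 ≤ v n) (hw : ∀ n, 0 ≤ w n) (hvf : ∀ n, v n ≤ (n.factorial : ℝ)⁻¹)
    {A B : H →L[ℂ] H} (hA : adjoint A = A) (hB : adjoint B = B)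
    (hAq : ∀ x, HasSum (fun n => w n * ‖proj (F n) x‖ ^ 2) (‖A x‖ ^ 2))
    (hBq : ∀ x, HasSum (fun n => v n * ‖proj (F n) x‖ ^ 2) (‖B x‖ ^ 2))
    (hAB : LinearMap.range A.toLinearMap ≤ LinearMap.range B.toLinearMap) :
    ∃ c : ℝ, ∀ m, v (m + 1) = 0 → w (m + 1) ≤ c * (((m + 2).factorial : ℝ))⁻¹ := by
  obtain ⟨c, hc⟩ := exists_norm_adjoint_le_of_range_subset (A := A) (B := B) (fun y => by
    obtain ⟨z, hz⟩ := hAB ⟨y, rfl⟩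
    exact ⟨z, hz.symm⟩)
  rw [hA, hB] at hc
  have hs : Summable v := Summable.of_nonneg_of_le hv hvf summable_inv_factorial
  refine ⟨c ^ 2 * 2, fun m hm => ?_⟩
  -- As `v (m + 1) = 0`, the tail effectively starts at `m + 2`, which gains the factor `m + 2` over
  -- `1 / (m + 1)!`.
  have htail : ∑' k, v (k + (m + 1)) ≤ 2 * (((m + 2).factorial : ℝ))⁻¹ := by
    rw [((summable_nat_add_iff (m + 1)).2 hs).tsum_eq_zero_add, zero_add, hm, zero_add]
    refine le_trans ?_ (tsum_inv_factorial_nat_add_le (m + 2) (by omega))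
    refine Summable.tsum_le_tsum (fun k => ?_) ?_
      ((summable_nat_add_iff (m + 2)).2 summable_inv_factorial)
    · rw [show k + 1 + (m + 1) = k + (m + 2) by ring]
      exact hvf _
    · simpa only [add_assoc] using (summable_nat_add_iff (1 + (m + 1))).2 hs
  obtain ⟨z, hzF, hz0, hzpos⟩ := exists_mem_proj_eq_zero (hmono (Nat.lt_succ_self m))
  have h1 := norm_sq_le_tail_of_hasSum hmono.monotone hv hs hz0 (hBq z)
  have h2 : w (m + 1) * ‖z‖ ^ 2 ≤ ‖A z‖ ^ 2 := by
    have := le_hasSum (hAq z) (m + 1) fun i _ => mul_nonneg (hw i) (sq_nonneg _)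
    rwa [proj_eq_self_iff.2 hzF] at this
  have h3 : ‖A z‖ ^ 2 ≤ c ^ 2 * ‖B z‖ ^ 2 := by
    rw [← mul_pow]
    have := hc z
    gcongr
  have h4 : w (m + 1) * ‖z‖ ^ 2 ≤ c ^ 2 * 2 * (((m + 2).factorial : ℝ))⁻¹ * ‖z‖ ^ 2 := by
    calc _ ≤ c ^ 2 * ((∑' k, v (k + (m + 1))) * ‖z‖ ^ 2) :=
          (h2.trans h3).trans (mul_le_mul_of_nonneg_left h1 (sq_nonneg c))
      _ ≤ c ^ 2 * ((2 * (((m + 2).factorial : ℝ))⁻¹) * ‖z‖ ^ 2) := by gcongr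
      _ = _ := by ring
  exact le_of_mul_le_mul_right h4 (by positivity)

/-- The inverse factorials, restricted to a set of indices. -/
noncomputable def factorialWeight (p : Set ℕ) : ℕ → ℝ :=
  p.indicator fun n => (n.factorial : ℝ)⁻¹

theorem factorialWeight_nonneg (p : Set ℕ) (n : ℕ) : 0 ≤ factorialWeight p n :=
  Set.indicator_nonneg (fun _ _ => by positivity) n

theorem factorialWeight_le (p : Set ℕ) (n : ℕ) : factorialWeight p n ≤ (n.factorial : ℝ)⁻¹ :=
  Set.indicator_le_self' (fun _ _ => by positivity) n

theorem summable_factorialWeight (p : Set ℕ) : Summable (factorialWeight p) :=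
  summable_inv_factorial.indicator p

/-- An inclusion would give `1 / (m + 1)! ≤ c / (m + 2)!`, that is `m + 2 ≤ c`, for arbitrarily
large `m`. -/
theorem not_range_le_of_factorialWeight {F : ℕ → ClosedSubmodule ℂ H} (hmono : StrictMono F)
    {p : Set ℕ} (hp : ∀ N, ∃ m, N ≤ m ∧ m + 1 ∈ p)
    {A B : H →L[ℂ] H} (hA : adjoint A = A) (hB : adjoint B = B)
    (hAq : ∀ x, HasSum (fun n => factorialWeight p n * ‖proj (F n) x‖ ^ 2) (‖A x‖ ^ 2))
    (hBq : ∀ x, HasSum (fun n => factorialWeight pᶜ n * ‖proj (F n) x‖ ^ 2) (‖B x‖ ^ 2)) :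
    ¬ LinearMap.range A.toLinearMap ≤ LinearMap.range B.toLinearMap := by
  intro hAB
  obtain ⟨c, hc⟩ := factorial_weight_le_of_range_le hmono (factorialWeight_nonneg _)
    (factorialWeight_nonneg _) (factorialWeight_le _) hA hB hAq hBq hAB
  obtain ⟨N, hN⟩ := exists_nat_gt c
  obtain ⟨m, hNm, hm⟩ := hp N
  have h := hc m (Set.indicator_of_notMem (by simpa using hm) _)
  rw [factorialWeight, Set.indicator_of_mem hm, Nat.factorial_succ (m + 1), Nat.cast_mul,
    mul_inv, ← mul_assoc] at h
  have h1 := le_of_mul_le_mul_right ((one_mul _).trans_le h) (by positivity)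
  rw [← div_eq_mul_inv, le_div_iff₀ (by positivity)] at h1
  have h2 : (N : ℝ) ≤ m := by exact_mod_cast hNm
  push_cast at h1
  linarith

/-- A strictly ascending sequence in `L` yields two incomparable invariant operator ranges. -/
theorem exists_incomparable_of_strictMono {L : CompleteSublattice (ClosedSubmodule ℂ H)}
    {F : ℕ → ClosedSubmodule ℂ H} (hF : ∀ n, F n ∈ L) (hmono : StrictMono F) :
    ∃ M N : Submodule ℂ H, IsInvariantOperatorRange L M ∧ IsInvariantOperatorRange L N ∧
      ¬ M ≤ N ∧ ¬ N ≤ M := by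
  let p : Set ℕ := {n | Even n}
  obtain ⟨A, hA, hAq⟩ :=
    exists_sqrt_sum_proj F (factorialWeight_nonneg p) (summable_factorialWeight p)
  obtain ⟨B, hB, hBq⟩ :=
    exists_sqrt_sum_proj F (factorialWeight_nonneg pᶜ) (summable_factorialWeight pᶜ)
  refine ⟨_, _, isInvariantOperatorRange_of_hasSum hF (factorialWeight_nonneg p) hA hAq,
    isInvariantOperatorRange_of_hasSum hF (factorialWeight_nonneg pᶜ) hB hBq,
    not_range_le_of_factorialWeight hmono (fun N => ⟨2 * N + 1, by omega, ?_⟩) hA hB hAq hBq,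
    not_range_le_of_factorialWeight hmono (p := pᶜ) (fun N => ⟨2 * N, by omega, ?_⟩) hB hA hBq
      (by rwa [compl_compl])⟩
  · exact ⟨N + 1, by ring⟩
  · simp [p]

end OperatorRanges

end SubspaceLattice

namespace SubspaceLattice

/-! ### Commuting projections, join-prime elements and atoms. -/

section Lattice

variable {H : Type*} [NormedAddCommGroup H] [InnerProductSpace ℂ H] [CompleteSpace H]
  {L : CompleteSublattice (ClosedSubmodule ℂ H)}

theorem proj_comm_apply {E F : ClosedSubmodule ℂ H} (h : Commute (proj E) (proj F)) (x : H) :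
    proj E (proj F x) = proj F (proj E x) :=
  DFunLike.congr_fun h.eq x

theorem proj_mem_of_commute {E F : ClosedSubmodule ℂ H} (h : Commute (proj E) (proj F)) {x : H}
    (hx : x ∈ F) : proj E x ∈ F := by
  rw [← proj_eq_self_iff.2 hx, proj_comm_apply h]
  exact proj_mem _ _

/-- If the projections commute, the closed span of two subspaces is their algebraic sum. -/
theorem mem_sup_iff_sub_proj_mem {E F : ClosedSubmodule ℂ H} (h : Commute (proj E) (proj F))
    {x : H} : x ∈ E ⊔ F ↔ x - proj E x ∈ F := by
  constructor
  · have hle : E ⊔ F ≤ F.comap (1 - proj E) := by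
      refine sup_le (fun y hy => ?_) fun y hy => ?_
      · change y - proj E y ∈ F
        rw [proj_eq_self_iff.2 hy, sub_self]
        exact F.toSubmodule.zero_mem
      · exact F.toSubmodule.sub_mem hy (proj_mem_of_commute h hy)
    exact fun hx => hle hx
  · intro hx
    rw [← add_sub_cancel (proj E x) x]
    exact add_mem ((le_sup_left : E ≤ E ⊔ F) (proj_mem E x))
      ((le_sup_right : F ≤ E ⊔ F) hx)

/-- `G` is join-prime in `L` with predecessor `G'`: every element of `L` either contains `G` or
meets it inside `G'`. -/
structure IsPrimeOver (L : CompleteSublattice (ClosedSubmodule ℂ H))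
    (G G' : ClosedSubmodule ℂ H) : Prop where
  mem : G ∈ L
  mem_pred : G' ∈ L
  lt : G' < G
  le_or_inf_le : ∀ F ∈ L, G ≤ F ∨ F ⊓ G ≤ G'

namespace IsPrimeOver

variable {G G' : ClosedSubmodule ℂ H}

/-- The atom `proj G - proj G'` vanishes on every `F` in `L` not containing `G`: commutativity puts
`proj G x` in `F ⊓ G ≤ G'`. -/
theorem proj_eq_of_mem (hL : IsCSL L) (h : IsPrimeOver L G G') {F : ClosedSubmodule ℂ H}
    (hF : F ∈ L) (hGF : ¬ G ≤ F) {x : H} (hx : x ∈ F) : proj G x = proj G' x := by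
  have hmem : proj G x ∈ G' :=
    (h.le_or_inf_le F hF).resolve_left hGF
      ⟨proj_mem_of_commute (hL G h.mem F hF) hx, proj_mem G x⟩
  rw [← proj_proj_of_le h.lt.le, proj_eq_self_iff.2 hmem]

theorem isLatticeAtom (hL : IsCSL L) (h : IsPrimeOver L G G') :
    IsLatticeAtom L (proj G - proj G') := by
  refine ⟨⟨G, h.mem, G', h.mem_pred, h.lt, rfl⟩, fun F hF => ?_⟩
  by_cases hGF : G ≤ F
  · refine .inr (ContinuousLinearMap.ext fun x => ?_)
    change proj G (proj F x) - proj G' (proj F x) = proj G x - proj G' x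
    rw [proj_proj_of_le hGF, proj_proj_of_le (h.lt.le.trans hGF)]
  · refine .inl (ContinuousLinearMap.ext fun x => ?_)
    change proj G (proj F x) - proj G' (proj F x) = 0
    rw [h.proj_eq_of_mem hL hF hGF (proj_mem F x), sub_self]

theorem range_subset_iff (hL : IsCSL L) (h : IsPrimeOver L G G') {F : ClosedSubmodule ℂ H}
    (hF : F ∈ L) : (∀ x, (proj G - proj G') x ∈ F) ↔ G ≤ F := by
  constructor
  · intro hx
    by_contra hGF
    obtain ⟨z, hzG, hz0, hzpos⟩ := exists_mem_proj_eq_zero h.lt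
    have h1 : z ∈ F := by
      have := hx z
      rwa [sub_apply, hz0, sub_zero, proj_eq_self_iff.2 hzG] at this
    have h2 := h.proj_eq_of_mem hL hF hGF h1
    rw [hz0, proj_eq_self_iff.2 hzG] at h2
    simp [h2] at hzpos
  · intro hGF x
    exact F.toSubmodule.sub_mem (hGF (proj_mem G x)) (hGF (h.lt.le (proj_mem G' x)))

/-- An invariant manifold with a vector outside the kernel of an atom contains the prime element
generated by that atom. -/
theorem le_of_isInvariantManifold (hL : IsCSL L) (h : IsPrimeOver L G G') {M : Submodule ℂ H}
    (hM : IsInvariantManifold L M) {x : H} (hx : x ∈ M) (hne : proj G x ≠ proj G' x) :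
    G.toSubmodule ≤ M := by
  intro y hy
  set a := proj G x - proj G' x with ha
  have hinner : ∀ z, inner ℂ a z = inner ℂ x (proj G z - proj G' z) := by
    intro z
    rw [ha, inner_sub_left, inner_sub_right, inner_proj_left, inner_proj_left]
  -- The operator `z ↦ ⟪a, z⟫ y` kills each `F` that does not contain `G`, and each other `F`
  -- contains `y`. It moves `x` to a non-zero multiple of `y` because `⟪a, x⟫ = ‖a‖²`.
  have hT : (innerSL ℂ a).smulRight y ∈ Alg L := by
    intro F hF z hz
    change inner ℂ a z • y ∈ F
    by_cases hGF : G ≤ F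
    · exact F.toSubmodule.smul_mem _ (hGF hy)
    · rw [hinner, h.proj_eq_of_mem hL hF hGF hz, sub_self, inner_zero_right, zero_smul]
      exact F.toSubmodule.zero_mem
  have hTx : inner ℂ a x • y ∈ M := hM _ hT x hx
  refine (M.smul_mem_iff fun h0 => hne ?_).1 hTx
  have hGa : proj G a = a := proj_eq_self_iff.2
    (G.toSubmodule.sub_mem (proj_mem G x) (h.lt.le (proj_mem G' x)))
  have hG'a : proj G' a = 0 := by
    rw [ha, map_sub, proj_proj_of_le h.lt.le, proj_eq_self_iff.2 (proj_mem G' x), sub_self]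
  have haa : inner ℂ a a = 0 := by
    conv_lhs => rw [hinner, hGa, hG'a, sub_zero]
    rw [← inner_conj_symm, h0, map_zero]
  exact sub_eq_zero.1 (inner_self_eq_zero.1 haa)

end IsPrimeOver

/-- If `Q` is covered by `P` in `L`, then `P` is the join of `Q` and a join-prime element. -/
theorem exists_isPrimeOver_of_cover (hL : IsCSL L) {P Q : ClosedSubmodule ℂ H} (hP : P ∈ L)
    (hQ : Q ∈ L) (hQP : Q < P) (hcov : ∀ F ∈ L, ¬ (Q < F ∧ F < P)) :
    ∃ G, IsPrimeOver L G (G ⊓ Q) ∧ Q ⊔ G = P := by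
  -- Its infimum still joins with `Q` to `P`: for `x` in `P`, membership in `Q ⊔ G` says `x - proj Q
  -- x ∈ G`, a condition that passes to intersections.
  let 𝒢 : Set (ClosedSubmodule ℂ H) := {G | G ∈ L ∧ Q ⊔ G = P}
  have hGL : sInf 𝒢 ∈ L := L.sInfClosed' fun G hG => hG.1
  have hGP : sInf 𝒢 ≤ P := sInf_le ⟨hP, sup_eq_right.2 hQP.le⟩
  have hsup : Q ⊔ sInf 𝒢 = P := by
    refine le_antisymm (sup_le hQP.le hGP) fun x hx => ?_
    rw [mem_sup_iff_sub_proj_mem (hL Q hQ _ hGL), ClosedSubmodule.mem_sInf]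
    intro G hG
    rw [← mem_sup_iff_sub_proj_mem (hL Q hQ G hG.1), hG.2]
    exact hx
  refine ⟨sInf 𝒢, ⟨hGL, L.infClosed' hGL hQ, ?_, fun F hF => ?_⟩, hsup⟩
  · rw [inf_lt_left]
    intro hle
    exact hQP.ne (by rw [← hsup, sup_eq_left.2 hle])
  · have hFG : F ⊓ sInf 𝒢 ∈ L := L.infClosed' hF hGL
    have hjoin : Q ⊔ F ⊓ sInf 𝒢 ∈ L := L.supClosed' hQ hFG
    have hle : Q ⊔ F ⊓ sInf 𝒢 ≤ P := sup_le hQP.le (inf_le_right.trans hGP)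
    by_cases heq : Q ⊔ F ⊓ sInf 𝒢 = P
    · exact .inl ((sInf_le (show F ⊓ sInf 𝒢 ∈ 𝒢 from ⟨hFG, heq⟩)).trans inf_le_left)
    · refine .inr (le_inf inf_le_right ?_)
      by_contra hnot
      exact hcov _ hjoin ⟨left_lt_sup.2 hnot, hle.lt_of_ne heq⟩

/-! ### The ascending chain condition and hyperatomicity. -/

theorem wellFoundedGT_iff_ascendingSequencesStabilize :
    WellFoundedGT L ↔ AscendingSequencesStabilize L := by
  rw [wellFoundedGT_iff_monotone_chain_condition]
  constructor
  · intro h F hF hmono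
    obtain ⟨n, hn⟩ := h ⟨fun n => ⟨F n, hF n⟩, fun i j hij => hmono hij⟩
    exact ⟨n, fun m hm => (congrArg Subtype.val (hn m hm)).symm⟩
  · intro h a
    obtain ⟨n, hn⟩ := h (fun n => a n) (fun n => (a n).2) fun i j hij => a.monotone hij
    exact ⟨n, fun m hm => Subtype.ext (hn m hm).symm⟩

theorem exists_strictMono_of_not_stabilize (h : ¬ AscendingSequencesStabilize L) :
    ∃ F : ℕ → ClosedSubmodule ℂ H, (∀ n, F n ∈ L) ∧ StrictMono F := by
  rw [← wellFoundedGT_iff_ascendingSequencesStabilize, WellFoundedGT, isWellFounded_iff,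
    RelEmbedding.wellFounded_iff_isEmpty, not_isEmpty_iff] at h
  obtain ⟨f⟩ := h
  exact ⟨fun n => f n, fun n => (f n).2, strictMono_nat_of_lt_succ fun n =>
    f.map_rel_iff.2 (Nat.lt_succ_self n)⟩

theorem exists_cover (hwf : AscendingSequencesStabilize L) {E P : ClosedSubmodule ℂ H}
    (hE : E ∈ L) (h : E < P) :
    ∃ Q ∈ L, E ≤ Q ∧ Q < P ∧ ∀ F ∈ L, ¬ (Q < F ∧ F < P) := by
  have := wellFoundedGT_iff_ascendingSequencesStabilize.2 hwf
  obtain ⟨Q, ⟨hEQ, hQP⟩, hmax⟩ := (wellFounded_gt (α := L)).has_min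
    {Q : L | E ≤ Q ∧ (Q : ClosedSubmodule ℂ H) < P} ⟨⟨E, hE⟩, le_rfl, h⟩
  exact ⟨Q, Q.2, hEQ, hQP, fun F hF hQF => hmax ⟨F, hF⟩ ⟨hEQ.trans hQF.1.le, hQF.2⟩ hQF.1⟩

theorem exists_finset_sSup_eq (hwf : AscendingSequencesStabilize L)
    (S : Set (ClosedSubmodule ℂ H)) (hS : ∀ E ∈ S, E ∈ L) :
    ∃ t : Finset (ClosedSubmodule ℂ H), (t : Set (ClosedSubmodule ℂ H)) ⊆ S ∧
      sSup S = t.sup id := by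
  have := wellFoundedGT_iff_ascendingSequencesStabilize.2 hwf
  obtain ⟨t, htS, ht⟩ := (CompleteLattice.wellFoundedGT_iff_isSupFiniteCompact L).1 this
    (Subtype.val ⁻¹' S)
  classical
  refine ⟨t.image Subtype.val, by simpa using htS, ?_⟩
  rw [Finset.sup_image, Function.id_comp, Finset.sup_eq_iSup]
  have h1 := congrArg Subtype.val ht
  rw [Finset.sup_eq_iSup] at h1
  simp only [CompleteSublattice.coe_sSup, CompleteSublattice.coe_iSup, id] at h1
  rw [← h1]
  congr 1
  ext E
  simp only [Set.mem_preimage, Set.mem_ofPred_eq]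
  constructor
  · exact fun hE => ⟨⟨E, hS E hE⟩, hE, rfl⟩
  · rintro ⟨s, hs, rfl⟩
    exact hs

/-- If the join-primes below `P` had a smaller join, a cover above that join would yield a
join-prime below `P` not under it. Finitely many suffice by the chain condition. -/
theorem isHyperatomic_of_stabilize (hL : IsCSL L) (hwf : AscendingSequencesStabilize L) :
    IsHyperatomic L := by
  intro P hP _
  let J : Set (ClosedSubmodule ℂ H) := {G | G ≤ P ∧ ∃ G', IsPrimeOver L G G'}
  have hJL : ∀ G ∈ J, G ∈ L := fun G ⟨_, _, hG⟩ => hG.mem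
  have hJP : sSup J = P := by
    by_contra hne
    have hlt : sSup J < P := (sSup_le fun G hG => hG.1).lt_of_ne hne
    obtain ⟨Q, hQ, hJQ, hQP, hcov⟩ := exists_cover hwf (L.sSupClosed' hJL) hlt
    obtain ⟨G, hG, hGP⟩ := exists_isPrimeOver_of_cover hL hP hQ hQP hcov
    have hGQ : G ≤ Q := (le_sSup (show G ∈ J from ⟨hGP ▸ le_sup_right, _, hG⟩)).trans hJQ
    exact hG.lt.ne (inf_eq_left.2 hGQ)
  obtain ⟨t, htJ, ht⟩ := exists_finset_sSup_eq hwf J hJL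
  choose! pred hpred using fun G (hG : G ∈ J) => hG.2
  refine ⟨(fun G => proj G - proj (pred G)) '' t, t.finite_toSet.image _, ?_, ?_⟩
  · rintro _ ⟨G, hG, rfl⟩
    exact (hpred G (htJ hG)).isLatticeAtom hL
  · have hle : ∀ F ∈ L, (∀ A ∈ (fun G => proj G - proj (pred G)) '' t, ∀ x, A x ∈ F) ↔ P ≤ F := by
      intro F hF
      rw [Set.forall_mem_image, ← hJP, ht, Finset.sup_le_iff]
      exact forall₂_congr fun G hG => (hpred G (htJ hG)).range_subset_iff hL hF
    refine le_antisymm (le_sInf fun F hF => (hle F hF.1).1 hF.2) (sInf_le ⟨hP, (hle P hP).2 le_rfl⟩)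

/-- Each of the finitely many atoms generating the supremum already has its range in some `F n`, so
the largest such index is where the sequence stops. -/
theorem stabilize_of_isHyperatomic (h : IsHyperatomic L) : AscendingSequencesStabilize L := by
  intro F hF hmono
  have hPL : (⨆ n, F n) ∈ L := L.sSupClosed' (by rintro _ ⟨n, rfl⟩; exact hF n)
  by_cases hbot : (⨆ n, F n) = ⊥
  · have h0 : ∀ n, F n = ⊥ := fun n => le_bot_iff.1 (hbot ▸ le_iSup F n)
    exact ⟨0, fun m _ => by rw [h0, h0]⟩
  obtain ⟨S, hSfin, hS, hgen⟩ := h _ hPL hbot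
  have hex : ∀ A ∈ S, ∃ n, ∀ x, A x ∈ F n := by
    intro A hA
    obtain ⟨⟨P, -, Q, -, hQP, rfl⟩, hatom⟩ := hS A hA
    have hsymm : ∀ x y, inner ℂ ((proj P - proj Q) x) y = inner ℂ x ((proj P - proj Q) y) := by
      intro x y
      simp only [sub_apply, inner_sub_left, inner_sub_right, inner_proj_left]
    by_cases hall : ∀ n, (proj P - proj Q) * proj (F n) = 0
    · exfalso
      -- The kernel of the atom would contain the supremum of the `F n`, which contains the atom's
      -- non-zero range.
      let K : ClosedSubmodule ℂ H := (⊥ : ClosedSubmodule ℂ H).comap (proj P - proj Q)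
      have hK : (⨆ n, F n) ≤ K := by
        refine iSup_le fun n x hx => ?_
        have := DFunLike.congr_fun (hall n) x
        rwa [mul_apply_eq_comp, proj_eq_self_iff.2 hx] at this
      obtain ⟨z, hzP, hz0, hzpos⟩ := exists_mem_proj_eq_zero hQP
      have hz : (proj P - proj Q) z = z := by
        rw [sub_apply, hz0, sub_zero, proj_eq_self_iff.2 hzP]
      have hzmem : z ∈ ⨆ n, F n := by
        rw [hgen, generatedBy, ClosedSubmodule.mem_sInf]
        intro E hE
        rw [← hz]
        exact hE.2 _ hA z
      have : (proj P - proj Q) z = 0 := hK hzmem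
      rw [hz] at this
      simp [this] at hzpos
    · push Not at hall
      obtain ⟨n, hn⟩ := hall
      have hAF := (hatom (F n) (hF n)).resolve_left hn
      refine ⟨n, fun x => ?_⟩
      rw [← proj_eq_self_iff]
      refine ext_inner_right ℂ fun y => ?_
      rw [inner_proj_left, hsymm, hsymm]
      exact congrArg (inner ℂ x) (DFunLike.congr_fun hAF y)
  choose! k hk using hex
  obtain ⟨n, hn⟩ := (hSfin.image k).bddAbove
  refine ⟨n, fun m hm => le_antisymm ?_ (hmono hm)⟩
  refine (le_iSup F m).trans ?_
  rw [hgen]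
  exact sInf_le ⟨hF n, fun A hA x => hmono (hn ⟨A, hA, rfl⟩) (hk A hA x)⟩

/-! ### Invariant manifolds under the chain condition. -/

theorem exists_mem_eq_of_isInvariantManifold (hL : IsCSL L)
    (hwf : AscendingSequencesStabilize L) {M : Submodule ℂ H} (hM : IsInvariantManifold L M) :
    ∃ E ∈ L, E.toSubmodule = M := by
  let S : Set (ClosedSubmodule ℂ H) := {F | F ∈ L ∧ F.toSubmodule ≤ M}
  have hEL : sSup S ∈ L := L.sSupClosed' fun F hF => hF.1
  have hEM : (sSup S).toSubmodule ≤ M := by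
    obtain ⟨t, htS, ht⟩ := exists_finset_sSup_eq hwf S fun F hF => hF.1
    suffices t.sup id ∈ S by rw [ht]; exact this.2
    -- Finite joins stay in `M` because the join of two subspaces with commuting projections is
    -- their algebraic sum.
    refine Finset.sup_induction (p := (· ∈ S)) ⟨CompleteSublattice.bot_mem, bot_le⟩
      (fun E hE F hF => ⟨L.supClosed' hE.1 hF.1, fun x hx => ?_⟩) fun E hE => htS hE
    have hx' := (mem_sup_iff_sub_proj_mem (hL E hE.1 F hF.1)).1 hx
    rw [← add_sub_cancel (proj E x) x]
    exact M.add_mem (hE.2 (proj_mem E x)) (hF.2 hx')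
  refine ⟨sSup S, hEL, le_antisymm hEM fun x hx => ?_⟩
  let P : ClosedSubmodule ℂ H := sInf {F | F ∈ L ∧ sSup S ≤ F ∧ x ∈ F}
  have hP : P ∈ L := L.sInfClosed' fun F hF => hF.1
  have hxP : x ∈ P := ClosedSubmodule.mem_sInf.2 fun F hF => hF.2.2
  have hEP : sSup S ≤ P := le_sInf fun F hF => hF.2.1
  rcases hEP.eq_or_lt with heq | hlt
  · exact heq ▸ hxP
  exfalso
  obtain ⟨Q, hQ, hEQ, hQP, hcov⟩ := exists_cover hwf hEL hlt
  obtain ⟨G, hG, hGP⟩ := exists_isPrimeOver_of_cover hL hP hQ hQP hcov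
  have hxQ : x ∉ Q := fun hxQ => hQP.not_ge (sInf_le ⟨hQ, hEQ, hxQ⟩)
  -- Otherwise the component `x - proj Q x`, which lies in `G`, would also lie in `Q`, against the
  -- minimality of `P`.
  have hne : proj G x ≠ proj (G ⊓ Q) x := by
    intro heq
    have h1 : x - proj Q x ∈ G :=
      (mem_sup_iff_sub_proj_mem (hL Q hQ G hG.mem)).1 (hGP.symm ▸ hxP)
    have h2 : x - proj Q x ∈ Q := by
      rw [← proj_eq_self_iff.2 h1, map_sub]
      refine Q.toSubmodule.sub_mem ?_ (proj_mem_of_commute (hL G hG.mem Q hQ) (proj_mem Q x))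
      rw [heq]
      exact (proj_mem (G ⊓ Q) x).2
    apply hxQ
    rw [← add_sub_cancel (proj Q x) x]
    exact Q.toSubmodule.add_mem (proj_mem Q x) h2
  have hGQ : G ≤ Q :=
    (le_sSup (show G ∈ S from ⟨hG.mem, hG.le_of_isInvariantManifold hL hM hx hne⟩)).trans hEQ
  exact hG.lt.ne (inf_eq_left.2 hGQ)

theorem stabilize_of_operatorRanges_isClosed
    (h : ∀ M : Submodule ℂ H, IsInvariantOperatorRange L M → IsClosed (M : Set H)) :
    AscendingSequencesStabilize L := by
  by_contra hnot
  obtain ⟨F, hF, hmono⟩ := exists_strictMono_of_not_stabilize hnot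
  obtain ⟨M, hM, hcl⟩ := exists_not_isClosed_of_strictMono hF hmono
  exact hcl (h M hM)

theorem stabilize_of_operatorRanges_total
    (h : ∀ M N : Submodule ℂ H, IsInvariantOperatorRange L M →
      IsInvariantOperatorRange L N → M ≤ N ∨ N ≤ M) :
    AscendingSequencesStabilize L := by
  by_contra hnot
  obtain ⟨F, hF, hmono⟩ := exists_strictMono_of_not_stabilize hnot
  obtain ⟨M, N, hM, hN, hMN, hNM⟩ := exists_incomparable_of_strictMono hF hmono
  exact (h M N hM hN).elim hMN hNM

/-! ### Immediate predecessors and nests. -/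

theorem hasImmediatePredecessors_of_stabilize (hwf : AscendingSequencesStabilize L) :
    HasImmediatePredecessors L := by
  intro P _ hne
  obtain ⟨Q, hQ, -, hQP, hcov⟩ :=
    exists_cover hwf CompleteSublattice.bot_mem (bot_lt_iff_ne_bot.2 hne)
  exact ⟨Q, hQ, hQP, hcov⟩

theorem stabilize_of_hasImmediatePredecessors (hN : IsNest L) (h : HasImmediatePredecessors L) :
    AscendingSequencesStabilize L := by
  intro F hF hmono
  have hPL : (⨆ n, F n) ∈ L := L.sSupClosed' (by rintro _ ⟨n, rfl⟩; exact hF n)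
  by_cases hbot : (⨆ n, F n) = ⊥
  · have h0 : ∀ n, F n = ⊥ := fun n => le_bot_iff.1 (hbot ▸ le_iSup F n)
    exact ⟨0, fun m _ => by rw [h0, h0]⟩
  obtain ⟨Q, hQ, hQP, hcov⟩ := h _ hPL hbot
  -- In a nest, a term not below the predecessor `Q` of the supremum lies strictly above `Q`, so it
  -- is the supremum.
  obtain ⟨n, hn⟩ : ∃ n, ¬ F n ≤ Q := by
    by_contra! hall
    exact hQP.not_ge (iSup_le hall)
  have hQF : Q < F n := lt_of_le_not_ge ((hN _ (hF n) _ hQ).resolve_left hn) hn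
  have heq : F n = ⨆ n, F n := by
    by_contra hne
    exact hcov _ (hF n) ⟨hQF, (le_iSup F n).lt_of_ne hne⟩
  exact ⟨n, fun m hm => le_antisymm (heq ▸ le_iSup F m) (hmono hm)⟩

end Lattice

end SubspaceLattice

theorem mainTheorem1 {H : Type*} [NormedAddCommGroup H] [InnerProductSpace ℂ H] [CompleteSpace H]
    [TopologicalSpace.SeparableSpace H] (L : CompleteSublattice (ClosedSubmodule ℂ H))
    (hL : SubspaceLattice.IsCSL L) :
    List.TFAE [
      SubspaceLattice.IsHyperatomic L,
      SubspaceLattice.AscendingSequencesStabilize L,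
      ∀ M : Submodule ℂ H, SubspaceLattice.IsInvariantOperatorRange L M → IsClosed (M : Set H),
      ∀ M : Submodule ℂ H, SubspaceLattice.IsInvariantManifold L M → IsClosed (M : Set H)] ∧
    ((∀ M : Submodule ℂ H, SubspaceLattice.IsInvariantOperatorRange L M → IsClosed (M : Set H)) →
      ∀ M : Submodule ℂ H, SubspaceLattice.IsInvariantOperatorRange L M →
        ∃ E ∈ L, E.toSubmodule = M) ∧
    ((∀ M : Submodule ℂ H, SubspaceLattice.IsInvariantManifold L M → IsClosed (M : Set H)) →
      ∀ M : Submodule ℂ H, SubspaceLattice.IsInvariantManifold L M →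
        ∃ E ∈ L, E.toSubmodule = M) ∧
    (SubspaceLattice.IsNest L →
      List.TFAE [
        SubspaceLattice.IsHyperatomic L,
        SubspaceLattice.AscendingSequencesStabilize L,
        ∀ M : Submodule ℂ H, SubspaceLattice.IsInvariantOperatorRange L M → IsClosed (M : Set H),
        ∀ M : Submodule ℂ H, SubspaceLattice.IsInvariantManifold L M → IsClosed (M : Set H),
        SubspaceLattice.HasImmediatePredecessors L,
        ∀ M N : Submodule ℂ H, SubspaceLattice.IsInvariantOperatorRange L M →
          SubspaceLattice.IsInvariantOperatorRange L N → M ≤ N ∨ N ≤ M,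
        ∀ M N : Submodule ℂ H, SubspaceLattice.IsInvariantManifold L M →
          SubspaceLattice.IsInvariantManifold L N → M ≤ N ∨ N ≤ M]) := by
  have h12 : SubspaceLattice.IsHyperatomic L ↔ SubspaceLattice.AscendingSequencesStabilize L :=
    ⟨SubspaceLattice.stabilize_of_isHyperatomic, SubspaceLattice.isHyperatomic_of_stabilize hL⟩
  have h2mem := fun hwf (M : Submodule ℂ H) (hM : SubspaceLattice.IsInvariantManifold L M) =>
    SubspaceLattice.exists_mem_eq_of_isInvariantManifold hL hwf hM
  have h24 : SubspaceLattice.AscendingSequencesStabilize L → ∀ M : Submodule ℂ H,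
      SubspaceLattice.IsInvariantManifold L M → IsClosed (M : Set H) := by
    intro hwf M hM
    obtain ⟨E, -, rfl⟩ := h2mem hwf M hM
    exact E.isClosed
  have h32 := SubspaceLattice.stabilize_of_operatorRanges_isClosed (L := L)
  refine ⟨?_, fun h M hM => h2mem (h32 h) M hM.1,
    fun h M hM => h2mem (h32 fun M hM => h M hM.1) M hM, fun hN => ?_⟩
  · tfae_have 1 ↔ 2 := h12
    tfae_have 2 → 4 := h24
    tfae_have 4 → 3 := fun h M hM => h M hM.1
    tfae_have 3 → 2 := h32
    tfae_finish
  · tfae_have 1 ↔ 2 := h12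
    tfae_have 2 → 4 := h24
    tfae_have 4 → 3 := fun h M hM => h M hM.1
    tfae_have 3 → 2 := h32
    tfae_have 2 → 5 := SubspaceLattice.hasImmediatePredecessors_of_stabilize
    tfae_have 5 → 2 := SubspaceLattice.stabilize_of_hasImmediatePredecessors hN
    tfae_have 2 → 7 := by
      intro hwf M N hM hN'
      obtain ⟨E, hE, rfl⟩ := h2mem hwf M hM
      obtain ⟨F, hF, rfl⟩ := h2mem hwf N hN'
      exact hN E hE F hF
    tfae_have 7 → 6 := fun h M N hM hN' => h M N hM.1 hN'.1
    tfae_have 6 → 2 := SubspaceLattice.stabilize_of_operatorRanges_total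
    tfae_finish
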